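/- Let $\mathcal{U}$ be a Grothendieck universe with $\omega\in\mathcal{U}$, and let $\mathcal{S}$ be the $\infty$-category of $\mathcal{U}$-small spaces (Kan complexes). A class $S$ of morphisms that is stable under pullback *has a classifier* if there is a morphism $t\in S$ which is a final object of the $\infty$-category whose objects are the morphisms in $S$ and whose morphisms are the cartesian squares. It is *closed under dependent products* if for all $f\colon X\to Y$ and $p\colon Z\to X$ in $S$ the dependent product $\prod_f p$ is in $S$, where $\prod_f$ is right adjoint to the pullback functor $f^*\colon\mathcal{S}_{/Y}\to\mathcal{S}_{/X}$. The universe $\mathcal{U}$ is *1-inaccessible* if for every $\mathcal{U}$-small cardinal $\mu$ there is a $\mathcal{U}$-small inaccessible cardinal $\kappa\ge\mu$. (i) Suppose that every morphism $f$ of $\mathcal{S}$ lies in a pullback-stable class $S$ of morphisms which has a classifier and is closed under dependent products. Then $\mathcal{U}$ is 1-inaccessible. (ii) The same holds for the ordinary category of $\mathcal{U}$-small sets in place of $\mathcal{S}$, where a classifier of a pullback-stable class $S$ is a morphism $t\colon\bar U\to U$ in $S$ such that for every $s\colon A\to X$ in $S$ there is a unique map $c\colon X\to U$ for which $s$ is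 a pullback of $t$ along $c$: if every map of $\mathcal{U}$-small sets lies in a pullback-stable class which has a classifier and is closed under dependent products, then $\mathcal{U}$ is 1-inaccessible. -/

import Mathlib

universe u v

namespace InftyUniverse

open CategoryTheory MonoidalCategory CartesianMonoidalCategory Simplicial Opposite SSet
open HomotopicalAlgebra SSet.modelCategoryQuillen

/-! ### Grothendieck universes -/

/-- A Grothendieck universe (containing the set of natural numbers), as a set of ZFC: a transitive
set closed under unordered pairs, power sets and unions of families indexed by its elements. -/
structure IsGrothendieckUniverse (U : ZFSet.{u}) : Prop where
  transitive : U.IsTransitive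
  omega_mem : ZFSet.omega ∈ U
  pair_mem : ∀ x ∈ U, ∀ y ∈ U, ({x, y} : ZFSet.{u}) ∈ U
  powerset_mem : ∀ x ∈ U, x.powerset ∈ U
  iUnion_mem : ∀ I ∈ U, ∀ F : I → ZFSet.{u}, (∀ i, F i ∈ U) → (ZFSet.range F).sUnion ∈ U

/-- A type is `U`-small if it is in bijection with an element of `U`. -/
def USmall (U : ZFSet.{u}) (T : Type u) : Prop :=
  ∃ x ∈ U, Nonempty (T ≃ x)

/-- `U` is `1`-inaccessible: the inaccessible `U`-small cardinals are unbounded among the `U`-small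
cardinals. Here the `U`-small cardinals are the cardinalities of the elements of `U`. -/
def IsOneInaccessible (U : ZFSet.{u}) : Prop :=
  ∀ x ∈ U, ∃ y ∈ U, y.card.IsInaccessible ∧ x.card ≤ y.card

/-! ### The axiom (DepProd) in an ordinary category -/

section Ordinary

variable {C : Type u} [Category.{v} C]

/-- `t` classifies `S`: it lies in `S`, and every morphism of `S` is a pullback of `t` along a
unique morphism. -/
def Classifies (S : MorphismProperty C) {E B : C} (t : E ⟶ B) : Prop :=
  S t ∧ ∀ ⦃A X : C⦄ (s : A ⟶ X), S s → ∃! c : X ⟶ B, ∃ c' : A ⟶ E, IsPullback c' s t c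

/-- `q : W ⟶ Y` is a dependent product of `p : Z ⟶ X` along `f : X ⟶ Y`: it is the value at `p` of
a right adjoint of the pullback functor `f^*`, i.e. there is a counit `ε : f^* q ⟶ p` over `X` such
that every morphism `g : f^* a ⟶ p` over `X` is `f^* k ≫ ε` for a unique `k : a ⟶ q` over `Y`. -/
def IsDependentProduct {X Y Z W : C} (f : X ⟶ Y) (p : Z ⟶ X) (q : W ⟶ Y) : Prop :=
  ∃ (W' : C) (πW : W' ⟶ W) (q' : W' ⟶ X) (_ : IsPullback πW q' q f)
    (ε : W' ⟶ Z) (_ : ε ≫ p = q'),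
    ∀ ⦃A A' : C⦄ (a : A ⟶ Y) (πA : A' ⟶ A) (a' : A' ⟶ X) (_ : IsPullback πA a' a f)
      (g : A' ⟶ Z), g ≫ p = a' →
      ∃! k : A ⟶ W, k ≫ q = a ∧ ∃ k' : A' ⟶ W', k' ≫ πW = πA ≫ k ∧ k' ≫ q' = a' ∧ k' ≫ ε = g

variable (C) in
/-- (DepProd) for an ordinary category: every morphism lies in a pullback-stable class of morphisms
which has a classifier and is closed under dependent products. -/
def DepProd : Prop :=
  ∀ ⦃X Y : C⦄ (f : X ⟶ Y), ∃ S : MorphismProperty C, S f ∧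
    (∀ ⦃A B A' B' : C⦄ (c' : A ⟶ A') (s : A ⟶ B) (t : A' ⟶ B') (c : B ⟶ B'),
      IsPullback c' s t c → S t → S s) ∧
    (∃ (E B : C) (t : E ⟶ B), Classifies S t) ∧
    (∀ ⦃X Y Z W : C⦄ (f : X ⟶ Y) (p : Z ⟶ X) (q : W ⟶ Y),
      S f → S p → IsDependentProduct f p q → S q)

end Ordinary

/-- The category of `U`-small sets. -/
abbrev USet (U : ZFSet.{u}) := ObjectProperty.FullSubcategory (fun T : Type u => USmall U T)

/-! ### The `∞`-category of `U`-small spaces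

It is presented by the simplicial category of `U`-small Kan complexes: the mapping space from `X`
to `Y` is the simplicial set whose `n`-simplices are the maps `X ⊗ Δ[n] ⟶ Y`. -/

/-- The category of `U`-small Kan complexes. -/
abbrev USpace (U : ZFSet.{u}) :=
  ObjectProperty.FullSubcategory
    (fun X : SSet.{u} => KanComplex X ∧ ∀ n : SimplexCategoryᵒᵖ, USmall U (X.obj n))

/-- Homotopy equivalences (applied below only to maps between Kan complexes). -/
def IsHomotopyEquiv {K L : SSet.{u}} (f : K ⟶ L) : Prop :=
  ∃ g : L ⟶ K, Nonempty (SSet.Homotopy (f ≫ g) (𝟙 K)) ∧ Nonempty (SSet.Homotopy (g ≫ f) (𝟙 L))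

/-- Contractibility (applied below only to Kan complexes). -/
def IsContractible (K : SSet.{u}) : Prop :=
  ∃ k : K _⦋0⦌, Nonempty (SSet.Homotopy (𝟙 K) (SSet.const k))

theorem stdSimplex_map_id (n : SimplexCategory) :
    SSet.stdSimplex.{u}.map (𝟙 n) = 𝟙 (SSet.stdSimplex.obj n) :=
  CategoryTheory.Functor.map_id _ _

theorem stdSimplex_map_comp {l m n : SimplexCategory} (φ : l ⟶ m) (ψ : m ⟶ n) :
    SSet.stdSimplex.{u}.map (φ ≫ ψ) = SSet.stdSimplex.map φ ≫ SSet.stdSimplex.map ψ :=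
  CategoryTheory.Functor.map_comp _ _ _

/-- A homotopy-commutative cone with apex `T` over the cospan `C ⟶ D ⟵ B`. -/
@[ext]
structure HCone {B C D : SSet.{u}} (g : C ⟶ D) (v : B ⟶ D) (T : SSet.{u}) where
  fst : T ⟶ C
  snd : T ⟶ B
  h : T ⊗ Δ[1] ⟶ D
  h₀ : ι₀ ≫ h = fst ≫ g
  h₁ : ι₁ ≫ h = snd ≫ v

/-- Restriction of a cone along a map of apices. -/
@[simps]
noncomputable def HCone.precomp {B C D : SSet.{u}} {g : C ⟶ D} {v : B ⟶ D} {T T' : SSet.{u}}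
    (c : HCone g v T) (α : T' ⟶ T) : HCone g v T' where
  fst := α ≫ c.fst
  snd := α ≫ c.snd
  h := α ▷ Δ[1] ≫ c.h
  h₀ := by rw [ι₀_comp_assoc, c.h₀, Category.assoc]
  h₁ := by rw [ι₁_comp_assoc, c.h₁, Category.assoc]

theorem HCone.precomp_id {B C D : SSet.{u}} {g : C ⟶ D} {v : B ⟶ D} {T : SSet.{u}}
    (c : HCone g v T) : c.precomp (𝟙 T) = c := by
  apply HCone.ext <;> simp

theorem HCone.precomp_comp {B C D : SSet.{u}} {g : C ⟶ D} {v : B ⟶ D} {T T' T'' : SSet.{u}}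
    (c : HCone g v T) (β : T'' ⟶ T') (α : T' ⟶ T) :
    c.precomp (β ≫ α) = (c.precomp α).precomp β := by
  apply HCone.ext <;> simp

/-- The homotopy pullback `C ×_D D^{Δ[1]} ×_D B`. Its `n`-simplices are the homotopy-commutative
cones with apex `Δ[n]`. -/
noncomputable def homotopyPullback {B C D : SSet.{u}} (g : C ⟶ D) (v : B ⟶ D) : SSet.{u} where
  obj n := HCone g v (SSet.stdSimplex.obj n.unop)
  map φ := ↾fun c => c.precomp (SSet.stdSimplex.map φ.unop)
  map_id n := by
    ext c : 3
    change c.precomp _ = c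
    rw [unop_id, stdSimplex_map_id, HCone.precomp_id]
  map_comp φ ψ := by
    ext c : 3
    change c.precomp _ = (c.precomp _).precomp _
    rw [unop_comp, stdSimplex_map_comp, HCone.precomp_comp]

/-- The map to the homotopy pullback which corresponds to a cone. -/
noncomputable def HCone.toHomotopyPullback {B C D : SSet.{u}} {g : C ⟶ D} {v : B ⟶ D}
    {T : SSet.{u}} (c : HCone g v T) : T ⟶ homotopyPullback g v where
  app n := ↾fun a => (c.precomp (yonedaEquiv.symm a) : HCone g v (SSet.stdSimplex.obj n.unop))
  naturality n m φ := by
    ext a : 3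
    change c.precomp _ = (c.precomp _).precomp _
    rw [← HCone.precomp_comp]
    congr 1
    exact (SSet.yonedaEquiv_symm_naturality_left φ.unop a).symm

/-- A morphism from `f` to `g` in the `∞`-category of arrows: a square which commutes up to the
homotopy `h`. -/
@[ext]
structure HSquare {A B C D : SSet.{u}} (f : A ⟶ B) (g : C ⟶ D) where
  top : A ⟶ C
  bot : B ⟶ D
  h : A ⊗ Δ[1] ⟶ D
  h₀ : ι₀ ≫ h = top ≫ g
  h₁ : ι₁ ≫ h = f ≫ bot

namespace HSquare

variable {A B C D : SSet.{u}} {f : A ⟶ B} {g : C ⟶ D}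

/-- The cone over `g` and the bottom map given by a homotopy-commutative square. -/
@[simps]
def cone (σ : HSquare f g) : HCone g σ.bot A where
  fst := σ.top
  snd := f
  h := σ.h
  h₀ := σ.h₀
  h₁ := σ.h₁

/-- A square of Kan complexes is cartesian, i.e. a pullback square in the `∞`-category of spaces,
if the comparison map to the homotopy pullback is a homotopy equivalence. -/
def IsCartesian (σ : HSquare f g) : Prop :=
  IsHomotopyEquiv σ.cone.toHomotopyPullback

/-- Precomposition with a commutative square. -/
@[simps]
noncomputable def precomp {A' B' : SSet.{u}} {f' : A' ⟶ B'} (σ : HSquare f g)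
    (α : A' ⟶ A) (β : B' ⟶ B) (w : f' ≫ β = α ≫ f) : HSquare f' g where
  top := α ≫ σ.top
  bot := β ≫ σ.bot
  h := α ▷ Δ[1] ≫ σ.h
  h₀ := by rw [ι₀_comp_assoc, σ.h₀, Category.assoc]
  h₁ := by rw [ι₁_comp_assoc, σ.h₁, reassoc_of% w]

theorem precomp_id (σ : HSquare f g) : σ.precomp (𝟙 A) (𝟙 B) (by simp) = σ := by
  apply HSquare.ext <;> simp

theorem precomp_precomp {A' B' A'' B'' : SSet.{u}} {f' : A' ⟶ B'} {f'' : A'' ⟶ B''}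
    (σ : HSquare f g) (α : A' ⟶ A) (β : B' ⟶ B) (w : f' ≫ β = α ≫ f)
    (α' : A'' ⟶ A') (β' : B'' ⟶ B') (w' : f'' ≫ β' = α' ≫ f') :
    (σ.precomp α β w).precomp α' β' w' =
      σ.precomp (α' ≫ α) (β' ≫ β) (by rw [reassoc_of% w', w, Category.assoc]) := by
  apply HSquare.ext <;> simp

theorem precomp_congr {A' B' : SSet.{u}} {f' : A' ⟶ B'} (σ : HSquare f g)
    {α₁ α₂ : A' ⟶ A} {β₁ β₂ : B' ⟶ B} (w₁ : f' ≫ β₁ = α₁ ≫ f) (w₂ : f' ≫ β₂ = α₂ ≫ f)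
    (hα : α₁ = α₂) (hβ : β₁ = β₂) : σ.precomp α₁ β₁ w₁ = σ.precomp α₂ β₂ w₂ := by
  subst hα hβ; rfl

/-- Reparametrization of a family of squares parametrized by `K` along a map `K' ⟶ K`. -/
noncomputable def reparam {K K' : SSet.{u}} (σ : HSquare (f ▷ K) g) (φ : K' ⟶ K) :
    HSquare (f ▷ K') g :=
  σ.precomp (A ◁ φ) (B ◁ φ) (whisker_exchange f φ).symm

theorem comp_lift_const {A B K : SSet.{u}} (f : A ⟶ B) (k : K _⦋0⦌) :
    f ≫ lift (𝟙 B) (SSet.const k) = lift (𝟙 A) (SSet.const k) ≫ f ▷ K := rfl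

/-- The member at the vertex `k` of a family of squares parametrized by `K`. -/
noncomputable def atVertex {K : SSet.{u}} (σ : HSquare (f ▷ K) g) (k : K _⦋0⦌) : HSquare f g :=
  σ.precomp (lift (𝟙 A) (SSet.const k)) (lift (𝟙 B) (SSet.const k)) (comp_lift_const f k)

theorem reparam_id {K : SSet.{u}} (σ : HSquare (f ▷ K) g) : σ.reparam (𝟙 K) = σ := by
  apply HSquare.ext <;> simp [reparam]

theorem reparam_comp {K K' K'' : SSet.{u}} (σ : HSquare (f ▷ K) g) (ψ : K'' ⟶ K') (φ : K' ⟶ K) :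
    σ.reparam (ψ ≫ φ) = (σ.reparam φ).reparam ψ := by
  apply HSquare.ext <;> simp [reparam]

theorem atVertex_reparam {K K' : SSet.{u}} (σ : HSquare (f ▷ K) g) (φ : K' ⟶ K) (k : K' _⦋0⦌) :
    (σ.reparam φ).atVertex k = σ.atVertex (φ.app _ k) := by
  unfold reparam atVertex
  rw [precomp_precomp]
  apply precomp_congr <;>
  · rw [lift_whiskerLeft]
    congr 1
    exact SSet.const_comp k φ

end HSquare

/-- The space of cartesian squares from `f` to `g`: the full subspace, on the vertices which are
cartesian squares, of the mapping space from `f` to `g` in the `∞`-category of arrows. The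
`n`-simplices of the latter are the families of squares parametrized by `Δ[n]`. -/
noncomputable def cartesianSquares {A B C D : SSet.{u}} (f : A ⟶ B) (g : C ⟶ D) : SSet.{u} where
  obj n := { σ : HSquare (f ▷ SSet.stdSimplex.obj n.unop) g // ∀ k, (σ.atVertex k).IsCartesian }
  map φ := ↾fun σ => ⟨σ.1.reparam (SSet.stdSimplex.map φ.unop), fun k => by
    rw [HSquare.atVertex_reparam]; exact σ.2 _⟩
  map_id n := by
    ext σ : 3
    refine Subtype.ext ?_
    change σ.1.reparam _ = σ.1
    rw [unop_id, stdSimplex_map_id, HSquare.reparam_id]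
  map_comp φ ψ := by
    ext σ : 3
    refine Subtype.ext ?_
    change σ.1.reparam _ = (σ.1.reparam _).reparam _
    rw [unop_comp, stdSimplex_map_comp, HSquare.reparam_comp]

/-- Families, parametrized by `K`, of maps over `Y` from `a : A ⟶ Y` to `q : W ⟶ Y`. -/
def RelHom {A W Y : SSet.{u}} (a : A ⟶ Y) (q : W ⟶ Y) (K : SSet.{u}) : Type u :=
  { g : A ⊗ K ⟶ W // g ≫ q = fst A K ≫ a }

/-- Reparametrization of a family of maps over `Y` along a map `K' ⟶ K`. -/
noncomputable def RelHom.reparam {A W Y : SSet.{u}} {a : A ⟶ Y} {q : W ⟶ Y} {K K' : SSet.{u}}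
    (g : RelHom a q K) (φ : K' ⟶ K) : RelHom a q K' :=
  ⟨A ◁ φ ≫ g.1, by rw [Category.assoc, g.2, whiskerLeft_fst_assoc]⟩

/-- For a Kan fibration `q : W ⟶ Y`, the mapping space from `a : A ⟶ Y` to `q` in the
`∞`-category of spaces over `Y`: the fiber over `a` of the map from `Map(A, W)` to `Map(A, Y)`. -/
noncomputable def relMap {A W Y : SSet.{u}} (a : A ⟶ Y) (q : W ⟶ Y) : SSet.{u} where
  obj n := RelHom a q (SSet.stdSimplex.obj n.unop)
  map φ := ↾fun g => g.reparam (SSet.stdSimplex.map φ.unop)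
  map_id n := by
    ext g : 3
    refine Subtype.ext ?_
    change A ◁ SSet.stdSimplex.map _ ≫ g.1 = g.1
    rw [unop_id, stdSimplex_map_id, whiskerLeft_id, Category.id_comp]
  map_comp φ ψ := by
    ext g : 3
    refine Subtype.ext ?_
    change A ◁ SSet.stdSimplex.map _ ≫ g.1 =
      A ◁ SSet.stdSimplex.map _ ≫ A ◁ SSet.stdSimplex.map _ ≫ g.1
    rw [unop_comp, stdSimplex_map_comp, whiskerLeft_comp, Category.assoc]

section RelMapPullback

variable {X Y Z W W' A A' : SSet.{u}} {f : X ⟶ Y} {p : Z ⟶ X} {q : W ⟶ Y}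
  {πW : W' ⟶ W} {q' : W' ⟶ X} (hq : IsPullback πW q' q f) (ε : W' ⟶ Z) (hε : ε ≫ p = q')
  {a : A ⟶ Y} {πA : A' ⟶ A} {a' : A' ⟶ X} (ha : IsPullback πA a' a f)

/-- Given pullbacks `a' = f^* a` and `q' = f^* q` along `f : X ⟶ Y`, and a map `ε : q' ⟶ p` over
`X`, this sends a map `k : a ⟶ q` over `Y` to `f^* k ≫ ε : f^* a ⟶ p`, in families. -/
noncomputable def RelHom.pullback {K : SSet.{u}} (k : RelHom a q K) : RelHom a' p K :=
  ⟨hq.lift (πA ▷ K ≫ k.1) (fst A' K ≫ a')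
    (by rw [Category.assoc, k.2, whiskerRight_fst_assoc, ha.w, Category.assoc]) ≫ ε,
    by rw [Category.assoc, hε, hq.lift_snd]⟩

theorem RelHom.pullback_reparam {K K' : SSet.{u}} (k : RelHom a q K) (φ : K' ⟶ K) :
    (k.reparam φ).pullback hq ε hε ha = (k.pullback hq ε hε ha).reparam φ := by
  refine Subtype.ext ?_
  simp only [RelHom.pullback, RelHom.reparam]
  rw [← Category.assoc (A' ◁ _)]
  congr 1
  apply hq.hom_ext
  · rw [hq.lift_fst, Category.assoc, hq.lift_fst, whisker_exchange_assoc]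
  · rw [hq.lift_snd, Category.assoc, hq.lift_snd, whiskerLeft_fst_assoc]

/-- The composite `Map_Y(a, q) ⟶ Map_X(f^* a, f^* q) ⟶ Map_X(f^* a, p)` of the action of `f^*` with
postcomposition with `ε`. -/
noncomputable def relMapPullback : relMap a q ⟶ relMap a' p where
  app n := ↾fun k => RelHom.pullback hq ε hε ha k
  naturality n m φ := by
    ext k : 3
    exact RelHom.pullback_reparam hq ε hε ha k _

end RelMapPullback

section Spaces

variable {U : ZFSet.{u}}

/-- Let `f : X ⟶ Y` be a map of spaces and let `p : Z ⟶ X`, `q : W ⟶ Y` be Kan fibrations. Then `q`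
is a dependent product of `p` along `f` in the `∞`-category of spaces if it is the value at `p` of a
right adjoint of the pullback functor `f^*` from spaces over `Y` to spaces over `X`: there is a
counit `ε : f^* q ⟶ p` over `X` such that the induced map `Map_Y(a, q) ⟶ Map_X(f^* a, p)` is an
equivalence for every space `a : A ⟶ Y` over `Y`.
The `∞`-category of spaces over `Y` is presented by the Kan fibrations over `Y`, and on these `f^*`
is the ordinary pullback. -/
def IsHDependentProduct {X Y Z W : USpace U} (f : X ⟶ Y) (p : Z ⟶ X) (q : W ⟶ Y) : Prop :=
  ∃ (W' : USpace U) (πW : W' ⟶ W) (q' : W' ⟶ X) (hq : IsPullback πW.hom q'.hom q.hom f.hom)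
    (ε : W' ⟶ Z) (hε : ε.hom ≫ p.hom = q'.hom),
    ∀ ⦃A A' : USpace U⦄ (a : A ⟶ Y) (πA : A' ⟶ A) (a' : A' ⟶ X), Fibration a.hom →
      ∀ ha : IsPullback πA.hom a'.hom a.hom f.hom,
        IsHomotopyEquiv (relMapPullback hq ε.hom hε ha)

/-- `t` classifies the class `S` of morphisms of spaces: it is a final object of the `∞`-category
with objects the morphisms in `S` and with morphisms the cartesian squares. -/
def HClassifies (S : MorphismProperty (USpace U)) {E B : USpace U} (t : E ⟶ B) : Prop :=
  S t ∧ ∀ ⦃A X : USpace U⦄ (s : A ⟶ X), S s → IsContractible (cartesianSquares s.hom t.hom)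

variable (U) in
/-- (DepProd) for the `∞`-category of `U`-small spaces: every morphism lies in a pullback-stable
class of morphisms which has a classifier and is closed under dependent products. Pullback-stability
is along all homotopy-commutative cartesian squares, so such a class is invariant under equivalence
of arrows; as every morphism is equivalent to a Kan fibration with the same target, closure under
dependent products can be expressed with fibrations `p` and `q`. -/
def HDepProd : Prop :=
  ∀ ⦃X Y : USpace U⦄ (f : X ⟶ Y), ∃ S : MorphismProperty (USpace U), S f ∧
    (∀ ⦃A B A' B' : USpace U⦄ (s : A ⟶ B) (t : A' ⟶ B') (σ : HSquare s.hom t.hom),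
      σ.IsCartesian → S t → S s) ∧
    (∃ (E B : USpace U) (t : E ⟶ B), HClassifies S t) ∧
    (∀ ⦃X Y Z W : USpace U⦄ (f : X ⟶ Y) (p : Z ⟶ X) (q : W ⟶ Y),
      Fibration p.hom → Fibration q.hom → S f → S p → IsHDependentProduct f p q → S q)

end Spaces

end InftyUniverse

namespace InftyUniverse

open CategoryTheory MonoidalCategory CartesianMonoidalCategory Simplicial Opposite SSet
open HomotopicalAlgebra SSet.modelCategoryQuillen

/-! ### Closure properties of `U`-small types -/

section Small

variable {U : ZFSet.{u}}

/-! Take an infinite small set `T₀`, a class `S` containing `T₀ → 1`, and let `P` be the class of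
small sets `T` with `T → 1` in `S`. If `T` and all `Z t` are in `P`, the classifying maps of the `Z
t → 1` assemble into a map from `T` to the base of the classifier, along which the classifier pulls
back to `(Σ t, Z t) → T`. This projection is therefore in `S`, and its dependent product along `T →
1` is `(∀ t, Z t) → 1`. So `P` is closed under dependent products. Its members are fibres of the
classifier, so their sizes have a small bound.

The supremum `κ` of these sizes is inaccessible (`exists_isInaccessible_of_pi`): the sets `T → T`
make it a strong limit that no member attains, and a cofinal family of length below `κ` would be
dominated by a single product in `P`.

For spaces, the same argument runs on discrete Kan complexes. Cartesian squares over points glue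
(`exists_isCartesian_glue`), the product of sets is a homotopical dependent product
(`isHDependentProduct_pi`), and a discrete homotopy fibre is bounded by vertices and edges of the
classifier (`HSquare.IsCartesian.nonempty_embedding`). -/

theorem IsGrothendieckUniverse.mem_of_subset (hU : IsGrothendieckUniverse U) {x y : ZFSet.{u}}
    (hx : x ∈ U) (hyx : y ⊆ x) : y ∈ U :=
  hU.transitive.mem_trans (ZFSet.mem_powerset.2 hyx) (hU.powerset_mem x hx)

theorem USmall.of_equiv {T T' : Type u} (h : USmall U T) (e : T' ≃ T) : USmall U T' := by
  obtain ⟨x, hx, ⟨e'⟩⟩ := h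
  exact ⟨x, hx, ⟨e.trans e'⟩⟩

theorem USmall.of_injective_to (hU : IsGrothendieckUniverse U) {T : Type u} {x : ZFSet.{u}}
    (hx : x ∈ U) (f : T → x) (hf : Function.Injective f) : USmall U T := by
  refine ⟨ZFSet.range fun t => (f t : ZFSet.{u}), hU.mem_of_subset hx ?_, ⟨?_⟩⟩
  · intro z hz
    obtain ⟨t, rfl⟩ := ZFSet.mem_range.1 hz
    exact (f t).2
  · refine Equiv.ofBijective (fun t => ⟨(f t : ZFSet.{u}), ZFSet.mem_range_self t⟩) ⟨?_, ?_⟩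
    · intro s t h
      exact hf (Subtype.ext (congrArg (fun z => (z.1 : ZFSet.{u})) h))
    · rintro ⟨z, hz⟩
      obtain ⟨t, rfl⟩ := ZFSet.mem_range.1 hz
      exact ⟨t, rfl⟩

theorem USmall.of_injective (hU : IsGrothendieckUniverse U) {T T' : Type u} (h : USmall U T')
    (f : T → T') (hf : Function.Injective f) : USmall U T := by
  obtain ⟨x, hx, ⟨e⟩⟩ := h
  exact .of_injective_to hU hx (e ∘ f) (e.injective.comp hf)

theorem USmall.set (hU : IsGrothendieckUniverse U) {T : Type u} (h : USmall U T) :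
    USmall U (Set T) := by
  obtain ⟨x, hx, ⟨e⟩⟩ := h
  refine .of_injective_to hU (hU.powerset_mem x hx)
    (fun s => ⟨ZFSet.range fun t : s => (e t : ZFSet.{u}), ZFSet.mem_powerset.2 ?_⟩) ?_
  · intro z hz
    obtain ⟨t, rfl⟩ := ZFSet.mem_range.1 hz
    exact (e t).2
  · intro s s' h
    have h' : ∀ z, z ∈ ZFSet.range (fun t : s => (e t : ZFSet.{u})) ↔
        z ∈ ZFSet.range fun t : s' => (e t : ZFSet.{u}) := by
      intro z
      have := congrArg (fun z => (z.1 : ZFSet.{u})) h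
      simp only at this
      rw [this]
    ext t
    have := h' (e t)
    simpa [ZFSet.mem_range, Subtype.ext_iff] using this

theorem USmall.sigma (hU : IsGrothendieckUniverse U) {T : Type u} {Z : T → Type u}
    (h : USmall U T) (hZ : ∀ t, USmall U (Z t)) : USmall U (Σ t, Z t) := by
  obtain ⟨x, hx, ⟨e⟩⟩ := h
  choose y hy hy' using hZ
  have e' := fun t => (hy' t).some
  have hsing : ∀ z ∈ U, ({z} : ZFSet.{u}) ∈ U := fun z hz => by
    simpa [ZFSet.pair_eq_singleton] using hU.pair_mem z hz z hz
  have hpair : ∀ z ∈ U, ∀ w ∈ U, ZFSet.pair z w ∈ U := fun z hz w hw =>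
    hU.pair_mem _ (hsing z hz) _ (hU.pair_mem z hz w hw)
  have hmem : ∀ {a b : ZFSet.{u}}, a ∈ b → b ∈ U → a ∈ U := fun h h' => hU.transitive.mem_trans h h'
  -- The set of coded pairs is built as a double union of singletons, since unions of indexed
  -- families are what the universe axioms supply.
  let F (i : x) (j : y (e.symm i)) : ZFSet.{u} := {ZFSet.pair i j}
  let G (i : x) : ZFSet.{u} := (ZFSet.range (F i)).sUnion
  have hG : ∀ i, G i ∈ U := fun i => hU.iUnion_mem _ (hy _) _ fun j =>
    hsing _ (hpair _ (hmem i.2 hx) _ (hmem j.2 (hy _)))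
  refine .of_injective_to hU (hU.iUnion_mem x hx G hG)
    (fun p => ⟨ZFSet.pair (e p.1) (e' p.1 p.2), ?_⟩) ?_
  · have hj : (e' p.1 p.2 : ZFSet.{u}) ∈ y (e.symm (e p.1)) := by
      rw [e.symm_apply_apply]; exact (e' p.1 p.2).2
    exact ZFSet.mem_sUnion.2 ⟨G (e p.1), ZFSet.mem_range_self _, ZFSet.mem_sUnion.2
      ⟨F (e p.1) ⟨_, hj⟩, ZFSet.mem_range_self _, ZFSet.mem_singleton.2 rfl⟩⟩
  · rintro ⟨t, z⟩ ⟨t', z'⟩ h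
    obtain ⟨h₁, h₂⟩ := ZFSet.pair_inj.1 (congrArg (fun z => (z.1 : ZFSet.{u})) h)
    obtain rfl : t = t' := e.injective (Subtype.ext h₁)
    obtain rfl : z = z' := (e' t).injective (Subtype.ext h₂)
    rfl

theorem USmall.prod (hU : IsGrothendieckUniverse U) {T T' : Type u}
    (h : USmall U T) (h' : USmall U T') : USmall U (T × T') :=
  (USmall.sigma hU h fun _ => h').of_equiv (Equiv.sigmaEquivProd T T').symm

/-- A function is determined by its graph, a subset of the sigma type. -/
theorem USmall.pi (hU : IsGrothendieckUniverse U) {T : Type u} {Z : T → Type u}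
    (h : USmall U T) (hZ : ∀ t, USmall U (Z t)) : USmall U (∀ t, Z t) := by
  refine .of_injective hU (.set hU (.sigma hU h hZ)) (fun f => {p | f p.1 = p.2}) ?_
  intro f g hfg
  ext t
  have h : (⟨t, f t⟩ : Σ t, Z t) ∈ {p | g p.1 = p.2} := by
    simp only at hfg
    rw [← hfg]; rfl
  exact h.symm

/-- The von Neumann numerals are distinct: a smaller one is an element of a larger one, and
membership is irreflexive. -/
theorem USmall.nat (hU : IsGrothendieckUniverse U) : USmall U (ULift.{u} ℕ) := by
  have hmem : ∀ n : ℕ, ((fun x : ZFSet.{u} => insert x x)^[n] ∅) ∈ ZFSet.omega.{u} := by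
    intro n
    induction n with
    | zero => exact ZFSet.omega_zero
    | succ n ih => rw [Function.iterate_succ_apply']; exact ZFSet.omega_succ ih
  have hlt : ∀ m n : ℕ, m < n → ((fun x : ZFSet.{u} => insert x x)^[m] ∅) ∈
      ((fun x : ZFSet.{u} => insert x x)^[n] ∅) := by
    intro m n h
    induction n with
    | zero => omega
    | succ n ih =>
      rw [Function.iterate_succ_apply', ZFSet.mem_insert_iff]
      obtain rfl | h := Nat.lt_succ_iff_lt_or_eq.1 h |>.symm
      · exact .inl rfl
      · exact .inr (ih h)
  refine .of_injective_to hU hU.omega_mem (fun n => ⟨_, hmem n.down⟩) ?_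
  rintro ⟨m⟩ ⟨n⟩ h
  have h := congrArg (fun z => (z.1 : ZFSet.{u})) h
  obtain h' | h' | h' := lt_trichotomy m n
  · have := hlt m n h'
    simp only at h
    rw [h] at this
    exact absurd this (ZFSet.mem_irrefl _)
  · rw [h']
  · have := hlt n m h'
    simp only at h
    rw [h] at this
    exact absurd this (ZFSet.mem_irrefl _)

theorem USmall.punit (hU : IsGrothendieckUniverse U) : USmall U PUnit.{u + 1} :=
  .of_injective hU (.nat hU) (fun _ => ⟨0⟩) fun _ _ _ => rfl

end Small

/-! ### Inaccessible cardinals from closure under dependent products -/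

open Cardinal in
/-- If a bounded class of types is closed under dependent products and contains an infinite type,
then the supremum of the cardinalities of its members is inaccessible. -/
theorem exists_isInaccessible_of_pi (P : Type u → Prop) (b : Cardinal.{u}) (hb : ∀ T, P T → #T ≤ b)
    (hpi : ∀ (T : Type u) (Z : T → Type u), P T → (∀ t, P (Z t)) → P (∀ t, Z t))
    (T₀ : Type u) (h₀ : P T₀) (hinf : ℵ₀ ≤ #T₀) :
    ∃ κ : Cardinal.{u}, κ.IsInaccessible ∧ #T₀ ≤ κ ∧ κ ≤ b := by
  let F : Set Cardinal.{u} := {c | ∃ T, P T ∧ #T = c}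
  have hF : BddAbove F := ⟨b, by rintro _ ⟨T, hT, rfl⟩; exact hb T hT⟩
  have hne : F.Nonempty := ⟨_, T₀, h₀, rfl⟩
  have hle : ∀ T, P T → #T ≤ sSup F := fun T hT => le_csSup hF ⟨T, hT, rfl⟩
  have hpow : ∀ T, P T → ℵ₀ ≤ #T → 2 ^ #T ≤ sSup F := fun T hT h => by
    refine le_trans ?_ (hle _ (hpi T (fun _ => T) hT fun _ => hT))
    rw [mk_pi, prod_const, Cardinal.lift_id]
    exact power_le_power_right ((natCast_lt_aleph0 (n := 2)).le.trans h)
  have h₀lt : #T₀ < sSup F := (cantor _).trans_le (hpow T₀ h₀ hinf)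
  -- Members of `P` are cofinal below the supremum, and finite ones can be replaced by `T₀`.
  have hlt : ∀ c < sSup F, ∃ T, P T ∧ c < #T ∧ ℵ₀ ≤ #T := fun c hc => by
    obtain ⟨_, ⟨T, hT, rfl⟩, h⟩ := exists_lt_of_lt_csSup hne hc
    obtain h' | h' := le_total (#T) (#T₀)
    · exact ⟨T₀, h₀, h.trans_le h', hinf⟩
    · exact ⟨T, hT, h, hinf.trans h'⟩
  refine ⟨sSup F, ⟨hinf.trans_lt h₀lt, ?_, ?_⟩, h₀lt.le, csSup_le hne ?_⟩
  -- Regularity: bound each term of a short cofinal family by some `Z i` in `P`. The product of the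
  -- `Z i` surjects onto each factor, so it is at least the supremum, although every infinite member
  -- is strictly below it.
  · by_contra! hcof
    obtain ⟨ι, f, hf, hι⟩ := Ordinal.exists_lsub_cof (sSup F).ord
    have hfi : ∀ i, f i < (sSup F).ord := fun i => hf ▸ Ordinal.lt_lsub f i
    choose Z hZ hfZ hZinf using fun i => hlt _ (lt_ord.1 (hfi i))
    obtain ⟨T, hT, hιT, -⟩ := hlt _ (hι ▸ hcof)
    have : Nonempty ι := by
      rw [← mk_ne_zero_iff, hι, Ne, Ordinal.cof_eq_zero, ord_eq_zero]
      exact (aleph0_pos.trans_le (hinf.trans h₀lt.le)).ne'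
    obtain ⟨i⟩ := hιT.le
    have hZne : ∀ i, Nonempty (Z i) := fun i =>
      mk_ne_zero_iff.1 (aleph0_pos.trans_le (hZinf i)).ne'
    -- The index type `ι` need not be in `P`, so the product is taken over a larger `T` in `P` that
    -- surjects onto it.
    let g : T → ι := Function.invFun i
    have hg : Function.Surjective g := Function.invFun_surjective i.injective
    have hW := hpi T (fun t => Z (g t)) hT fun t => hZ _
    have hWle : ∀ i, #(Z i) ≤ #(∀ t, Z (g t)) := fun i => by
      obtain ⟨t, rfl⟩ := hg i
      exact mk_le_of_surjective (f := fun w : ∀ t, Z (g t) => w t)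
        (Function.surjective_eval (β := fun t => Z (g t)) t)
    have hWinf : ℵ₀ ≤ #(∀ t, Z (g t)) := (hZinf (Classical.arbitrary ι)).trans (hWle _)
    have hWlt : #(∀ t, Z (g t)) < sSup F := (cantor _).trans_le (hpow _ hW hWinf)
    have : (sSup F).ord ≤ (#(∀ t, Z (g t))).ord := by
      rw [← hf]
      exact Ordinal.lsub_le fun i => lt_ord.2 ((hfZ i).trans_le (hWle i))
    exact absurd (ord_le_ord.1 this) hWlt.not_ge
  -- Strong limit: `2 ^ c` is at most the size of `T → T`, an infinite member of `P`, hence strictly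
  -- below the supremum.
  · intro c hc
    obtain ⟨T, hT, h, hTinf⟩ := hlt c hc
    have hW := hpi T (fun _ => T) hT fun _ => hT
    have h2 : 2 ^ c ≤ #(T → T) := by
      rw [mk_pi, prod_const, Cardinal.lift_id]
      exact (power_le_power_left two_ne_zero h.le).trans
        (power_le_power_right ((natCast_lt_aleph0 (n := 2)).le.trans hTinf))
    have hWinf : ℵ₀ ≤ #(T → T) := by
      rw [mk_pi, prod_const, Cardinal.lift_id]
      exact hTinf.trans ((cantor _).le.trans
        (power_le_power_right ((natCast_lt_aleph0 (n := 2)).le.trans hTinf)))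
    exact h2.trans_lt ((cantor _).trans_le (hpow _ hW hWinf))
  · rintro _ ⟨T, hT, rfl⟩
    exact hb T hT

open Cardinal in
/-- `U` is `1`-inaccessible if every `U`-small type lies in a class of types which is closed under
dependent products and bounded by a `U`-small type. -/
theorem isOneInaccessible_of_pi {U : ZFSet.{u}} (hU : IsGrothendieckUniverse U)
    (h : ∀ T₀ : Type u, USmall U T₀ → ∃ P : Type u → Prop, P T₀ ∧
      (∀ (T : Type u) (Z : T → Type u), P T → (∀ t, P (Z t)) → P (∀ t, Z t)) ∧
      ∃ E : Type u, USmall U E ∧ ∀ T, P T → Nonempty (T ↪ E)) :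
    IsOneInaccessible U := by
  intro x hx
  have hxs : USmall U (Shrink.{u} x) := ⟨x, hx, ⟨(equivShrink x).symm⟩⟩
  have hsum : USmall U (Shrink.{u} x ⊕ PUnit.{u + 1}) := by
    refine .of_injective hU (.set hU hxs) (Sum.elim (fun a => {a}) fun _ => ∅) ?_
    rintro (a | a) (b | b) h <;> simp_all
  -- The set `(x + 1) × ℕ` contains a copy of `x`; the added point keeps it infinite when `x` is
  -- empty.
  obtain ⟨P, hP, hpi, E, ⟨z, hz, ⟨e⟩⟩, hE⟩ :=
    h (Σ _ : Shrink.{u} x ⊕ PUnit.{u + 1}, ULift.{u} ℕ) (.sigma hU hsum fun _ => .nat hU)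
  obtain ⟨κ, hκ, hle, hκE⟩ := exists_isInaccessible_of_pi P #E (fun T hT => hE T hT) hpi _ hP
    (by
      rw [aleph0_le_mk_iff]
      exact .of_injective (fun n : ℕ => ⟨.inr ⟨⟩, ⟨n⟩⟩) fun m n h => by simpa using h)
  -- A subset of `E` of size `κ`, carried into `z`, realizes `κ` as the cardinality of an element of
  -- `U`.
  obtain ⟨s, hs⟩ := le_mk_iff_exists_set.1 hκE
  let y := ZFSet.range fun t : s => (e t : ZFSet.{u})
  have hy : y.card = κ := by
    rw [← hs, ZFSet.card, Cardinal.eq]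
    refine ⟨(equivShrink y).symm.trans (Equiv.ofBijective
      (fun t : s => (⟨e t, ZFSet.mem_range_self (f := fun t : s => (e t : ZFSet.{u})) t⟩ : y))
      ⟨fun t t' h => ?_, ?_⟩).symm⟩
    · exact Subtype.ext (e.injective (Subtype.ext (congrArg (fun z => (z.1 : ZFSet.{u})) h)))
    · rintro ⟨w, hw⟩
      obtain ⟨t, rfl⟩ := ZFSet.mem_range.1 hw
      exact ⟨t, rfl⟩
  refine ⟨y, hU.mem_of_subset hz ?_, hy ▸ hκ, ?_⟩
  · intro w hw
    obtain ⟨t, rfl⟩ := ZFSet.mem_range.1 hw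
    exact (e t).2
  · rw [hy]
    refine le_trans ?_ hle
    exact mk_le_of_injective (f := fun a => ⟨.inl a, ⟨0⟩⟩) fun a b h => by simpa using h

/-! ### Sets -/

section Sets

variable {U : ZFSet.{u}}

namespace USet

/-- The morphism of `U`-small sets given by a function. -/
abbrev ofFun {X Y : USet U} (f : X.obj → Y.obj) : X ⟶ Y :=
  ObjectProperty.homMk (↾f)

/-- Elements are maps out of the one-point set, which is small; conversely, the inclusion into all
types reflects pullbacks. -/
theorem isPullback_iff (hU : IsGrothendieckUniverse U) {A B C D : USet U}
    (t : A ⟶ B) (l : A ⟶ C) (r : B ⟶ D) (b : C ⟶ D) :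
    IsPullback t l r b ↔ (∀ x, r.hom (t.hom x) = b.hom (l.hom x)) ∧
      (∀ x y, t.hom x = t.hom y → l.hom x = l.hom y → x = y) ∧
      ∀ y z, r.hom y = b.hom z → ∃ x, t.hom x = y ∧ l.hom x = z := by
  constructor
  · intro h
    let one : USet U := ⟨PUnit, .punit hU⟩
    refine ⟨fun x => congrArg (fun f => f.hom x) h.w, fun x y h₁ h₂ => ?_, fun y z hyz => ?_⟩
    · have : (ofFun fun _ => x : one ⟶ A) = ofFun fun _ => y := by
        apply h.hom_ext
        · ext; exact h₁
        · ext; exact h₂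
      exact congrArg (fun f => f.hom PUnit.unit) this
    · have w : (ofFun fun _ => y : one ⟶ B) ≫ r = (ofFun fun _ => z : one ⟶ C) ≫ b := by
        ext; exact hyz
      exact ⟨(h.lift _ _ w).hom PUnit.unit,
        congrArg (fun f => f.hom PUnit.unit) (h.lift_fst _ _ w),
        congrArg (fun f => f.hom PUnit.unit) (h.lift_snd _ _ w)⟩
  · rintro ⟨h₁, h₂, h₃⟩
    have w : t ≫ r = l ≫ b := by ext x; exact h₁ x
    refine IsPullback.of_map (ObjectProperty.ι _) w ?_
    rw [Limits.Types.isPullback_iff]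
    exact ⟨congrArg (fun f => f.hom) w, fun x y h => h₂ x y h.1 h.2, h₃⟩

end USet

/-- For a family of sets `Z t`, the projection `∏ Z ⟶ 1` is a dependent product of `∐ Z ⟶ T` along
`T ⟶ 1`. -/
theorem isDependentProduct_pi (hU : IsGrothendieckUniverse U) {T : Type u} {Z : T → Type u}
    (hT : USmall U T) (hS : USmall U (Σ t, Z t)) (hP : USmall U (∀ t, Z t))
    (h₁ : USmall U PUnit.{u + 1}) :
    IsDependentProduct (C := USet U) (X := ⟨T, hT⟩) (Y := ⟨PUnit, h₁⟩) (Z := ⟨Σ t, Z t, hS⟩)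
      (W := ⟨∀ t, Z t, hP⟩) (USet.ofFun fun _ => PUnit.unit) (USet.ofFun Sigma.fst)
      (USet.ofFun fun _ => PUnit.unit) := by
  refine ⟨⟨(∀ t, Z t) × T, .prod hU hP hT⟩, USet.ofFun Prod.fst, USet.ofFun Prod.snd, ?_,
    USet.ofFun fun w => ⟨w.2, w.1 w.2⟩, rfl, ?_⟩
  · rw [USet.isPullback_iff hU]
    exact ⟨fun _ => rfl, fun x y h h' => Prod.ext h h', fun y z _ => ⟨(y, z), rfl, rfl⟩⟩
  · intro A A' a πA a' ha g hg
    rw [USet.isPullback_iff hU] at ha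
    obtain ⟨-, ha₂, ha₃⟩ := ha
    have hg' : ∀ x, (g.hom x).1 = a'.hom x := fun x => congrArg (fun f => f.hom x) hg
    -- Since `A'` is `A × T`, `s α t` is its unique point over `α` and `t`; the transpose of `g`
    -- reads off the component of `g` there.
    choose s hs hs' using fun α (t : T) => ha₃ α t (Subsingleton.elim (α := PUnit) _ _)
    have hsπ : ∀ x, s (πA.hom x) (a'.hom x) = x := fun x => ha₂ _ _ (hs _ _) (hs' _ _)
    have hg₂ : ∀ α t, (g.hom (s α t)).1 = t := fun α t => (hg' _).trans (hs' _ _)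
    refine ⟨USet.ofFun fun α t => (hg₂ α t) ▸ (g.hom (s α t)).2, ⟨rfl,
      USet.ofFun fun x => ⟨fun t => (hg₂ (πA.hom x) t) ▸ (g.hom (s (πA.hom x) t)).2, a'.hom x⟩,
      rfl, rfl, ?_⟩, ?_⟩
    · ext x : 4
      have : (⟨a'.hom x, hg₂ (πA.hom x) (a'.hom x) ▸ (g.hom (s (πA.hom x) (a'.hom x))).2⟩ :
          Σ t, Z t) = g.hom x := by
        refine Sigma.ext (hg' x).symm ((eqRec_heq _ _).trans ?_)
        rw [hsπ]
      exact this
    · rintro k ⟨-, k', hk₁, hk₂, hk₃⟩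
      ext α t
      have e₁ : (k'.hom (s α t)).1 = k.hom α := by
        exact (congrArg (fun f => f.hom (s α t)) hk₁).trans (congrArg (fun b => k.hom b) (hs α t))
      have e₂ : (k'.hom (s α t)).2 = t :=
        (congrArg (fun f => f.hom (s α t)) hk₂).trans (hs' α t)
      have e₃ : (⟨(k'.hom (s α t)).2, (k'.hom (s α t)).1 (k'.hom (s α t)).2⟩ : Σ t, Z t) =
        g.hom (s α t) := congrArg (fun f => f.hom (s α t)) hk₃
      rw [e₁, e₂] at e₃
      change k.hom α t = hg₂ α t ▸ (g.hom (s α t)).2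
      apply eq_of_heq
      refine HEq.trans ?_ (eqRec_heq _ _).symm
      rw [← e₃]

theorem isOneInaccessible_of_depProd (hU : IsGrothendieckUniverse U) (h : DepProd (USet U)) :
    IsOneInaccessible U := by
  have h₁ := USmall.punit hU
  refine isOneInaccessible_of_pi hU fun T₀ hT₀ => ?_
  obtain ⟨S, hS, hpb, ⟨E, B, t, ht, hcl⟩, hprod⟩ :=
    h (USet.ofFun fun _ => PUnit.unit : (⟨T₀, hT₀⟩ : USet U) ⟶ ⟨PUnit, h₁⟩)
  refine ⟨fun T => ∃ hT : USmall U T,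
    S (USet.ofFun fun _ => PUnit.unit : (⟨T, hT⟩ : USet U) ⟶ ⟨PUnit, h₁⟩), ⟨hT₀, hS⟩, ?_,
    E.obj, E.property, ?_⟩
  · rintro T Z ⟨hT, hTS⟩ hZ
    choose hZ hZS using hZ
    have hsig := USmall.sigma hU hT hZ
    choose c hc hc' using fun i => hcl _ (hZS i)
    choose c' hpbk using hc
    simp only [USet.isPullback_iff hU] at hpbk
    refine ⟨.pi hU hT hZ, hprod _ _ _ hTS ?_ (isDependentProduct_pi hU hT hsig _ h₁)⟩
    -- The points `c i` of the base form one map out of `T`, which classifies the whole projection.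
    refine hpb (USet.ofFun fun z : Σ i, Z i => (c' z.1).hom z.2) _ t
      (USet.ofFun fun i => (c i).hom PUnit.unit) ?_ ht
    rw [USet.isPullback_iff hU]
    refine ⟨fun z => (hpbk z.1).1 z.2, ?_, fun y i hy => ?_⟩
    · rintro ⟨i, z⟩ ⟨i', z'⟩ hz hi
      obtain rfl : i = i' := hi
      exact congrArg _ ((hpbk i).2.1 z z' hz trivial)
    · obtain ⟨z, hz, -⟩ := (hpbk i).2.2 y PUnit.unit hy
      exact ⟨⟨i, z⟩, hz, rfl⟩
  · rintro T ⟨hT, hTS⟩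
    obtain ⟨c, ⟨c', hc⟩, -⟩ := hcl _ hTS
    rw [USet.isPullback_iff hU] at hc
    exact ⟨⟨fun x => c'.hom x, fun x y hxy => hc.2.1 x y hxy rfl⟩⟩

end Sets

/-! ### Homotopies and homotopy equivalences -/

/-- A homotopy from a map out of the cylinder. -/
def homotopyMk {K L : SSet.{u}} {f g : K ⟶ L} (h : K ⊗ Δ[1] ⟶ L) (h₀ : ι₀ ≫ h = f)
    (h₁ : ι₁ ≫ h = g) : SSet.Homotopy f g where
  h := h
  h₀ := h₀
  h₁ := h₁
  -- The homotopy is relative to the empty subcomplex, so this condition is vacuous.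
  rel := by
    ext n ⟨⟨x, hx⟩, y⟩
    exact hx.elim

/-- The constant homotopy. -/
def homotopyRefl {K L : SSet.{u}} (f : K ⟶ L) : SSet.Homotopy f f :=
  homotopyMk (fst K Δ[1] ≫ f) rfl rfl

theorem IsHomotopyEquiv.of_isIso {K L : SSet.{u}} (f : K ⟶ L) [IsIso f] : IsHomotopyEquiv f :=
  ⟨inv f, ⟨by rw [IsIso.hom_inv_id]; exact homotopyRefl _⟩,
    ⟨by rw [IsIso.inv_hom_id]; exact homotopyRefl _⟩⟩

theorem IsHomotopyEquiv.of_bijective {K L : SSet.{u}} (f : K ⟶ L)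
    (hf : ∀ n, Function.Bijective (f.app n)) : IsHomotopyEquiv f := by
  have : IsIso f := by
    rw [NatTrans.isIso_iff_isIso_app]
    intro n
    rw [isIso_iff_bijective]
    exact hf n
  exact .of_isIso f

/-! ### Coproduct decompositions -/

/-- The maps `j t : K t ⟶ L` exhibit `L` as a coproduct, levelwise. -/
def IsCoproductFamily {T : Type u} {K : T → SSet.{u}} {L : SSet.{u}} (j : ∀ t, K t ⟶ L) : Prop :=
  ∀ n, Function.Bijective fun p : Σ t, (K t).obj n => (j p.1).app n p.2

namespace IsCoproductFamily

variable {T : Type u} {K : T → SSet.{u}} {L M : SSet.{u}} {j : ∀ t, K t ⟶ L}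

theorem hom_ext (hj : IsCoproductFamily j) {f g : L ⟶ M} (h : ∀ t, j t ≫ f = j t ≫ g) :
    f = g := by
  ext n x
  obtain ⟨⟨t, y⟩, rfl⟩ := (hj n).2 x
  exact congrArg (fun f => f.app n y) (h t)

/-- Each simplex lies in exactly one summand, and simplicial operators preserve the summand. -/
theorem exists_desc (hj : IsCoproductFamily j) (φ : ∀ t, K t ⟶ M) :
    ∃ f : L ⟶ M, ∀ t, j t ≫ f = φ t := by
  choose s hs using fun n x => (hj n).2 x
  have hs' : ∀ n (p : Σ t, (K t).obj n), s n ((j p.1).app n p.2) = p := fun n p =>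
    (hj n).1 (hs n _)
  refine ⟨{ app n := ↾fun x => (φ (s n x).1).app n (s n x).2, naturality := ?_ }, ?_⟩
  · intro n m α
    ext x
    obtain ⟨⟨t, y⟩, rfl⟩ := (hj n).2 x
    have e : L.map α ((j t).app n y) = (j t).app m ((K t).map α y) :=
      (NatTrans.naturality_apply (j t) α y).symm
    change (φ (s m (L.map α ((j t).app n y))).1).app m (s m (L.map α ((j t).app n y))).2 =
      M.map α ((φ (s n ((j t).app n y)).1).app n (s n ((j t).app n y)).2)
    rw [e, hs' m ⟨t, _⟩, hs' n ⟨t, _⟩]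
    exact NatTrans.naturality_apply (φ t) α y
  · intro t
    ext n y
    change (φ (s n ((j t).app n y)).1).app n (s n ((j t).app n y)).2 = _
    rw [hs' n ⟨t, _⟩]
    rfl

theorem whiskerRight (hj : IsCoproductFamily j) (M : SSet.{u}) :
    IsCoproductFamily fun t => j t ▷ M := by
  intro n
  constructor
  · rintro ⟨t, x, z⟩ ⟨t', x', z'⟩ h
    have h₁ : (j t).app n x = (j t').app n x' := congrArg Prod.fst h
    obtain rfl : z = z' := congrArg Prod.snd h
    cases (hj n).1 (a₁ := ⟨t, x⟩) (a₂ := ⟨t', x'⟩) h₁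
    rfl
  · rintro ⟨x, z⟩
    obtain ⟨⟨t, y⟩, rfl⟩ := (hj n).2 x
    exact ⟨⟨t, y, z⟩, rfl⟩

/-- The cylinder of a coproduct is the coproduct of the cylinders, so homotopies glue. -/
theorem nonempty_homotopy (hj : IsCoproductFamily j) {f g : L ⟶ M}
    (h : ∀ t, Nonempty (SSet.Homotopy (j t ≫ f) (j t ≫ g))) : Nonempty (SSet.Homotopy f g) := by
  obtain ⟨H, hH⟩ := (hj.whiskerRight Δ[1]).exists_desc fun t => (h t).some.h
  refine ⟨homotopyMk H (hj.hom_ext fun t => ?_) (hj.hom_ext fun t => ?_)⟩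
  · rw [← ι₀_comp_assoc, hH, SSet.Homotopy.h₀]
  · rw [← ι₁_comp_assoc, hH, SSet.Homotopy.h₁]

/-- A coproduct of homotopy equivalences is a homotopy equivalence. -/
theorem isHomotopyEquiv {K' : T → SSet.{u}} {L' : SSet.{u}} {j' : ∀ t, K' t ⟶ L'}
    (hj : IsCoproductFamily j) (hj' : IsCoproductFamily j') (e : L ⟶ L') (e' : ∀ t, K t ⟶ K' t)
    (he : ∀ t, j t ≫ e = e' t ≫ j' t) (he' : ∀ t, IsHomotopyEquiv (e' t)) :
    IsHomotopyEquiv e := by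
  choose g hg₁ hg₂ using he'
  obtain ⟨G, hG⟩ := hj'.exists_desc fun t => g t ≫ j t
  refine ⟨G, hj.nonempty_homotopy fun t => ?_, hj'.nonempty_homotopy fun t => ?_⟩
  · obtain ⟨H⟩ := hg₁ t
    refine ⟨homotopyMk (H.h ≫ j t) ?_ ?_⟩
    · rw [H.h₀_assoc, reassoc_of% (he t), hG, Category.assoc]
    · rw [H.h₁_assoc, Category.id_comp, Category.comp_id]
  · obtain ⟨H⟩ := hg₂ t
    refine ⟨homotopyMk (H.h ≫ j' t) ?_ ?_⟩
    · rw [H.h₀_assoc, reassoc_of% (hG t), he, Category.assoc]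
    · rw [H.h₁_assoc, Category.id_comp, Category.comp_id]

end IsCoproductFamily

/-! ### Discrete simplicial sets -/

/-- The discrete simplicial set on a type. -/
abbrev disc (T : Type u) : SSet.{u} := (Functor.const SimplexCategoryᵒᵖ).obj T

/-- The map of discrete simplicial sets given by a function. -/
abbrev discMap {T T' : Type u} (f : T → T') : disc T ⟶ disc T' :=
  (Functor.const SimplexCategoryᵒᵖ).map (↾f)

section Disc

variable {T : Type u} {K : SSet.{u}}

theorem disc_app_map (F : K ⟶ disc T) {n m : SimplexCategoryᵒᵖ} (α : n ⟶ m) (x : K.obj n) :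
    F.app m (K.map α x) = F.app n x :=
  NatTrans.naturality_apply F α x

theorem disc_app_stdSimplex {n : SimplexCategory} (F : stdSimplex.obj n ⟶ disc T)
    {m : SimplexCategoryᵒᵖ} (x : (stdSimplex.obj n).obj m) : F.app m x = yonedaEquiv F := by
  obtain ⟨F, rfl⟩ := yonedaEquiv.symm.surjective F
  rw [Equiv.apply_symm_apply]
  rfl

/-- On each `{x} × Δ[1]` the homotopy is a map from a simplex to a discrete object, hence constant.
-/
theorem disc_ι₀_comp_eq {T' : Type u} (H : disc T' ⊗ Δ[1] ⟶ disc T) : ι₀ ≫ H = ι₁ ≫ H := by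
  ext n x
  let G : Δ[1] ⟶ disc T :=
    { app := fun m => ↾fun s => H.app m (x, s)
      naturality := fun m m' α => by
        ext s
        exact disc_app_map H α ((x, s) : (disc T' ⊗ Δ[1]).obj m) }
  exact (disc_app_stdSimplex G (ι₀.app n x).2).trans (disc_app_stdSimplex G (ι₁.app n x).2).symm

theorem disc_homotopy_eq {T' : Type u} {f g : disc T' ⟶ disc T} (H : SSet.Homotopy f g) :
    f = g :=
  H.h₀.symm.trans ((disc_ι₀_comp_eq H.h).trans H.h₁)

theorem isCoproductFamily_disc {T : Type u} (Z : T → Type u) :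
    IsCoproductFamily fun t => discMap (fun z : Z t => (⟨t, z⟩ : Σ t, Z t)) :=
  fun _ => Function.bijective_id

/-! ### Maps of discrete simplicial sets are Kan fibrations -/

/-- A horn is connected: a simplex in it misses some `j ≠ i`, and the edge joining its first vertex
to `i` misses the same `j`, so it lies in the horn. -/
theorem disc_app_horn {n : ℕ} {i : Fin (n + 2)} (F : (Λ[n + 1, i] : SSet.{u}) ⟶ disc T) :
    ∃ z : T, ∀ (m : SimplexCategoryᵒᵖ) (x : (Λ[n + 1, i] : SSet.{u}).obj m), F.app m x = z := by
  let v (a : Fin (n + 2)) : (Δ[n + 1] : SSet.{u}) _⦋0⦌ := stdSimplex.obj₀Equiv.symm a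
  have hv : ∀ a j : Fin (n + 2), j ≠ i → j ≠ a →
      v a ∈ (Λ[n + 1, i] : (Δ[n + 1] : SSet.{u}).Subcomplex).obj _ := fun a j hj hja => by
    rw [mem_horn_iff_notMem_range]
    refine ⟨j, hj, ?_⟩
    rintro ⟨x, rfl⟩
    exact hja rfl
  have hedge : ∀ (a b j : Fin (n + 2)) (hab : a ≤ b) (hj : j ≠ i) (hja : j ≠ a) (hjb : j ≠ b),
      F.app _ ⟨v a, hv a j hj hja⟩ = F.app _ ⟨v b, hv b j hj hjb⟩ := by
    intro a b j hab hj hja hjb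
    have he : stdSimplex.edge (n + 1) a b hab ∈
        (Λ[n + 1, i] : (Δ[n + 1] : SSet.{u}).Subcomplex).obj _ := by
      rw [mem_horn_iff_notMem_range]
      refine ⟨j, hj, ?_⟩
      rintro ⟨x, rfl⟩
      fin_cases x
      · exact hja rfl
      · exact hjb rfl
    have h₁ := disc_app_map F (SimplexCategory.δ 1).op ⟨_, he⟩
    have h₀ := disc_app_map F (SimplexCategory.δ 0).op ⟨_, he⟩
    refine Eq.trans ?_ (h₁.trans (h₀.symm.trans ?_))
    · congr 1
      refine Subtype.ext (stdSimplex.obj₀Equiv.injective ?_)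
      rfl
    · congr 1
      refine Subtype.ext (stdSimplex.obj₀Equiv.injective ?_)
      rfl
  obtain ⟨j₀, hj₀⟩ := exists_ne i
  refine ⟨F.app _ ⟨v i, hv i j₀ hj₀ hj₀⟩, ?_⟩
  rintro ⟨⟨m⟩⟩ ⟨x, hx⟩
  obtain ⟨j, hj, hjx⟩ := (mem_horn_iff_notMem_range _ _).1 hx
  have hj' : j ≠ x 0 := fun h => hjx ⟨0, h.symm⟩
  have h := disc_app_map F (SimplexCategory.const ⦋0⦌ ⦋m⦌ 0).op ⟨x, hx⟩
  refine h.symm.trans (Eq.trans (b := F.app _ ⟨v (x 0), hv _ j hj hj'⟩) ?_ ?_)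
  · congr 1
  · obtain hle | hle := le_total (x 0) i
    · exact hedge _ _ j hle hj hj' hj
    · exact (hedge _ _ j hle hj hj hj').symm

/-- The map out of the horn is constant, say at `z`, and so is the map out of the simplex. Comparing
them at the vertex `i` of the horn shows that the constant filler at `z` works. -/
theorem fibration_discMap {T' : Type u} (f : T → T') : Fibration (discMap f) := by
  rw [fibration_iff]
  intro A B i hi
  simp only [J, MorphismProperty.iSup_iff] at hi
  obtain ⟨n, ⟨i⟩⟩ := hi
  refine ⟨fun {a b} sq => ?_⟩
  obtain ⟨z, hz⟩ := disc_app_horn a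
  obtain ⟨j, hj⟩ := exists_ne i
  have hx : stdSimplex.obj₀Equiv.symm i ∈
      (Λ[n + 1, i] : (Δ[n + 1] : SSet.{u}).Subcomplex).obj (op ⦋0⦌) := by
    rw [mem_horn_iff_notMem_range]
    refine ⟨j, hj, ?_⟩
    rintro ⟨x, rfl⟩
    exact hj rfl
  have hzb : f z = yonedaEquiv b := by
    rw [← hz _ ⟨_, hx⟩]
    exact (congrArg (fun F => F.app _ ⟨_, hx⟩) sq.w).trans (disc_app_stdSimplex b _)
  refine ⟨⟨{ l := { app := fun _ => ↾fun _ => z }, fac_left := ?_, fac_right := ?_ }⟩⟩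
  · ext m x
    exact (hz m x).symm
  · ext m x
    exact hzb.trans (disc_app_stdSimplex b x).symm

theorem kanComplex_disc (T : Type u) : KanComplex (disc T) := by
  have h : Limits.IsTerminal (disc PUnit.{u + 1}) :=
    Limits.IsTerminal.ofUniqueHom (fun _ => { app := fun _ => ↾fun _ => PUnit.unit })
      fun _ _ => by ext; rfl
  rw [KanComplex, isFibrant_iff_of_isTerminal (discMap fun _ => PUnit.unit) h]
  exact fibration_discMap _

end Disc

/-! ### Gluing cartesian squares over a discrete base -/

/-- The map of homotopy pullbacks induced by a map over the base. -/
noncomputable def homotopyPullbackMap {B B' C D : SSet.{u}} {g : C ⟶ D} {v : B ⟶ D} {v' : B' ⟶ D}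
    (w : B ⟶ B') (hw : w ≫ v' = v) : homotopyPullback g v ⟶ homotopyPullback g v' where
  app n := ↾fun c : HCone g v (stdSimplex.obj n.unop) =>
    ({ fst := c.fst, snd := c.snd ≫ w, h := c.h, h₀ := c.h₀,
       h₁ := by rw [c.h₁, Category.assoc, hw] } : HCone g v' (stdSimplex.obj n.unop))

section Glue

variable {T : Type u} {C D : SSet.{u}} {g : C ⟶ D}

/-- The inclusion of a point into a discrete simplicial set. -/
abbrev discPoint (t : T) : disc PUnit.{u + 1} ⟶ disc T :=
  discMap fun _ => t

/-- The leg of a cone from a simplex to a discrete base is constant, so the cone lies over a single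
point. -/
theorem isCoproductFamily_homotopyPullback {v : ∀ _ : T, disc PUnit.{u + 1} ⟶ D} {v' : disc T ⟶ D}
    (hv : ∀ t, discPoint t ≫ v' = v t) :
    IsCoproductFamily fun t => homotopyPullbackMap (g := g) (discPoint t) (hv t) := by
  have hsnd : ∀ (n : SimplexCategory) (s : stdSimplex.obj n ⟶ disc PUnit.{u + 1}) (t : T),
      yonedaEquiv (s ≫ discPoint t) = t := fun _ _ _ => rfl
  intro n
  constructor
  · rintro ⟨t, c⟩ ⟨t', c'⟩ h
    have hs : c.snd ≫ discPoint t = c'.snd ≫ discPoint t' := congrArg HCone.snd h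
    obtain rfl : t = t' := congrArg yonedaEquiv hs
    have hc : c = c' := by
      have hfst := congrArg (HCone.fst (g := g) (v := v')) h
      have hh := congrArg (HCone.h (g := g) (v := v')) h
      refine HCone.ext hfst ?_ hh
      ext; rfl
    rw [hc]
  · intro (c : HCone g v' (stdSimplex.obj n.unop))
    let t : T := yonedaEquiv c.snd
    let s : stdSimplex.obj n.unop ⟶ disc PUnit.{u + 1} :=
      { app := fun _ => ↾fun _ => PUnit.unit }
    have hs : c.snd = s ≫ discPoint t := by
      ext m x
      exact disc_app_stdSimplex c.snd x
    refine ⟨⟨t, ({ fst := c.fst, snd := s, h := c.h, h₀ := c.h₀, h₁ := ?_ } :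
      HCone g (v t) (stdSimplex.obj n.unop))⟩, ?_⟩
    · rw [c.h₁, hs, Category.assoc, hv]
    · exact HCone.ext rfl hs.symm rfl

/-- Cartesian squares over the points of a discrete base glue. -/
theorem exists_isCartesian_glue {Z : T → Type u}
    (σ : ∀ t, HSquare (discMap fun _ : Z t => PUnit.unit) g) (hσ : ∀ t, (σ t).IsCartesian) :
    ∃ τ : HSquare (discMap (Sigma.fst : (Σ t, Z t) → T)) g, τ.IsCartesian := by
  have hj := isCoproductFamily_disc Z
  have hb : IsCoproductFamily fun t : T => discPoint t := fun n =>
    ⟨by rintro ⟨t, x⟩ ⟨t', x'⟩ h; obtain rfl : t = t' := h; rfl, fun t => ⟨⟨t, PUnit.unit⟩, rfl⟩⟩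
  obtain ⟨top, htop⟩ := hj.exists_desc fun t => (σ t).top
  obtain ⟨bot, hbot⟩ := hb.exists_desc fun t => (σ t).bot
  obtain ⟨h, hh⟩ := (hj.whiskerRight Δ[1]).exists_desc fun t => (σ t).h
  let τ : HSquare (discMap (Sigma.fst : (Σ t, Z t) → T)) g :=
    { top := top
      bot := bot
      h := h
      h₀ := hj.hom_ext fun t => by
        rw [← ι₀_comp_assoc, hh, (σ t).h₀, reassoc_of% (htop t)]
      h₁ := hj.hom_ext fun t => by
        rw [← ι₁_comp_assoc, hh, (σ t).h₁, ← hbot t]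
        rfl }
  -- The comparison map of `τ` is the coproduct of the comparison maps of the `σ t`.
  refine ⟨τ, hj.isHomotopyEquiv (isCoproductFamily_homotopyPullback hbot) _ _ (fun t => ?_) hσ⟩
  ext n z
  refine HCone.ext ?_ ?_ ?_
  · change yonedaEquiv.symm _ ≫ top = yonedaEquiv.symm z ≫ (σ t).top
    rw [← htop]
    rfl
  · rfl
  · change yonedaEquiv.symm _ ▷ Δ[1] ≫ h = yonedaEquiv.symm z ▷ Δ[1] ≫ (σ t).h
    rw [← hh]
    rfl

end Glue

/-- A contractible space of cartesian squares contains a cartesian square. -/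
theorem exists_isCartesian_of_isContractible {A B C D : SSet.{u}} {f : A ⟶ B} {g : C ⟶ D}
    (h : IsContractible (cartesianSquares f g)) : ∃ σ : HSquare f g, σ.IsCartesian := by
  obtain ⟨σ, -⟩ := h
  exact ⟨_, σ.2 (stdSimplex.obj₀Equiv.symm 0)⟩

/-- A discrete homotopy fibre of `g : C ⟶ D` embeds into `C₀ × D₁`. -/
theorem HSquare.IsCartesian.nonempty_embedding {T : Type u} {C D : SSet.{u}} {g : C ⟶ D}
    {σ : HSquare (discMap fun _ : T => PUnit.unit) g} (hσ : σ.IsCartesian) :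
    Nonempty (T ↪ C _⦋0⦌ × D _⦋1⦌) := by
  obtain ⟨r, ⟨H⟩, -⟩ := hσ
  -- Homotopic self-maps of a discrete object are equal, so the comparison map has a strict left
  -- inverse and is injective on vertices.
  have hr := disc_homotopy_eq H
  let c (x : T) : HCone g σ.bot Δ[0] := σ.cone.toHomotopyPullback.app (op ⦋0⦌) x
  have hc : Function.Injective c := fun x y hxy => by
    have hx := congrArg (fun F => F.app (op ⦋0⦌) x) hr
    have hy := congrArg (fun F => F.app (op ⦋0⦌) y) hr
    exact hx.symm.trans ((congrArg (fun c => r.app (op ⦋0⦌) c) hxy).trans hy)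
  -- Through `i`, the homotopy of a cone with apex `Δ[0]` becomes an edge of `D`; the leg to the
  -- point carries no information.
  let i : Δ[1] ⟶ Δ[0] ⊗ Δ[1] := lift (SSet.const (stdSimplex.obj₀Equiv.symm 0)) (𝟙 _)
  have hi : snd Δ[0] Δ[1] ≫ i = 𝟙 _ :=
    CartesianMonoidalCategory.hom_ext _ _ stdSimplex.ext₀ (by simp [i])
  refine ⟨⟨fun x => (yonedaEquiv (c x).fst, yonedaEquiv (i ≫ (c x).h)), fun x y hxy => ?_⟩⟩
  have h₁ := yonedaEquiv.injective (congrArg Prod.fst hxy)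
  have h₂ := yonedaEquiv.injective (congrArg Prod.snd hxy)
  refine hc (HCone.ext h₁ ?_ ?_)
  · ext; rfl
  · rw [← Category.id_comp (c x).h, ← Category.id_comp (c y).h, ← hi, Category.assoc, h₂,
      Category.assoc]

/-! ### Dependent products of discrete spaces -/

theorem isPullback_iff_app {A B C D : SSet.{u}} (t : A ⟶ B) (l : A ⟶ C) (r : B ⟶ D) (b : C ⟶ D) :
    IsPullback t l r b ↔ ∀ n, IsPullback (t.app n) (l.app n) (r.app n) (b.app n) := by
  constructor
  · intro h n
    exact h.map ((evaluation _ _).obj n)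
  · intro h
    have w : t ≫ r = l ≫ b := NatTrans.ext (funext fun n => (h n).w)
    refine ⟨⟨w⟩, ⟨Limits.evaluationJointlyReflectsLimits _ fun n => ?_⟩⟩
    exact (Limits.isLimitMapConePullbackConeEquiv ((evaluation _ _).obj n) w).symm (h n).isLimit

section DependentProduct

variable {U : ZFSet.{u}}

/-- A discrete space. -/
abbrev discSpace {T : Type u} (hT : USmall U T) : USpace U :=
  ⟨disc T, kanComplex_disc T, fun _ => hT⟩

/-- A map of discrete spaces. -/
abbrev discSpaceMap {T T' : Type u} (hT : USmall U T) (hT' : USmall U T') (f : T → T') :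
    discSpace hT ⟶ discSpace hT' :=
  ObjectProperty.homMk (discMap f)

/-- Levelwise `A'` is `A × T`, so this is currying in sets. The discrete targets have trivial
simplicial operators, which makes the transpose natural; no homotopies enter. -/
theorem relHomPullback_bijective {T : Type u} {Z : T → Type u} {A A' : SSet.{u}}
    (hq : IsPullback (discMap (Prod.fst : (∀ t, Z t) × T → _)) (discMap Prod.snd)
      (discMap fun _ => PUnit.unit.{u + 1}) (discMap fun _ => PUnit.unit))
    {a : A ⟶ disc PUnit.{u + 1}} {πA : A' ⟶ A} {a' : A' ⟶ disc T}
    (ha : IsPullback πA a' a (discMap fun _ => PUnit.unit)) (K : SSet.{u}) :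
    Function.Bijective (RelHom.pullback hq
      (discMap fun w => (⟨w.2, w.1 w.2⟩ : Σ t, Z t)) (p := discMap Sigma.fst) rfl ha (K := K)) := by
  have happ : ∀ (k : RelHom a (discMap fun _ : ∀ t, Z t => PUnit.unit.{u + 1}) K) m
      (x : A'.obj m) (y : K.obj m),
      (RelHom.pullback hq (discMap fun w => (⟨w.2, w.1 w.2⟩ : Σ t, Z t)) (p := discMap Sigma.fst)
        rfl ha k).1.app m (x, y) =
        (⟨a'.app m x, (k.1.app m (πA.app m x, y) : ∀ t, Z t) (a'.app m x)⟩ : Σ t, Z t) := by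
    intro k m x y
    have w : (πA ▷ K ≫ k.1) ≫ discMap (fun _ => PUnit.unit.{u + 1}) =
        (fst A' K ≫ a') ≫ discMap fun _ => PUnit.unit := by ext; rfl
    have e : (hq.lift (πA ▷ K ≫ k.1) (fst A' K ≫ a') w).app m (x, y) =
        ((k.1.app m (πA.app m x, y), a'.app m x) : (∀ t, Z t) × T) :=
      Prod.ext (congrArg (fun F => F.app m (x, y)) (hq.lift_fst _ _ w))
        (congrArg (fun F => F.app m (x, y)) (hq.lift_snd _ _ w))
    exact congrArg (fun w : (∀ t, Z t) × T => (⟨w.2, w.1 w.2⟩ : Σ t, Z t)) e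
  have hA : ∀ m (α : A.obj m) (t : T), ∃ x, πA.app m x = α ∧ a'.app m x = t := fun m α t =>
    ((Limits.Types.isPullback_iff _ _ _ _).1 ((isPullback_iff_app _ _ _ _).1 ha m)).2.2 α t rfl
  have hA' : ∀ m (x y : A'.obj m), πA.app m x = πA.app m y → a'.app m x = a'.app m y → x = y :=
    fun m x y h h' => ((Limits.Types.isPullback_iff _ _ _ _).1
      ((isPullback_iff_app _ _ _ _).1 ha m)).2.1 x y ⟨h, h'⟩
  constructor
  · intro k k' h
    refine Subtype.ext ?_
    refine NatTrans.ext (funext fun m => ?_)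
    ext ⟨α, y⟩
    refine funext fun t => ?_
    obtain ⟨x, rfl, rfl⟩ := hA m α t
    have e := congrArg (fun F => F.1.app m (x, y)) h
    simp only [happ] at e
    exact eq_of_heq (Sigma.mk.inj e).2
  · rintro ⟨G, hG⟩
    have hGt : ∀ m (x : A'.obj m) (y : K.obj m),
        (G.app m (x, y) : Σ t, Z t).1 = a'.app m x := fun m x y =>
      congrArg (fun F => F.app m (x, y)) hG
    -- The value of the transpose at a simplex and `t` is read off from `G` at the unique simplex of
    -- `A'` above them.
    have hz : ∀ m (αy : A.obj m × K.obj m) (t : T), ∃ z : Z t, ∀ x, πA.app m x = αy.1 →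
        a'.app m x = t → G.app m (x, αy.2) = (⟨t, z⟩ : Σ t, Z t) := by
      rintro m ⟨α, y⟩ t
      obtain ⟨x, rfl, rfl⟩ := hA m α t
      obtain ⟨z, hz⟩ : ∃ z : Z (a'.app m x), (G.app m (x, y) : Σ t, Z t) = ⟨a'.app m x, z⟩ := by
        rw [← hGt m x y]
        exact ⟨_, rfl⟩
      exact ⟨z, fun x' h h' => by rw [hA' m x' x h h']; exact hz⟩
    choose k hk using hz
    refine ⟨⟨{ app := fun m => ↾fun αy => k m αy, naturality := ?_ }, ?_⟩, ?_⟩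
    · intro m m' φ
      ext ⟨α, y⟩
      refine funext fun t => ?_
      obtain ⟨x, hx, hx'⟩ := hA m α t
      have e₁ := hk m (α, y) t x hx hx'
      have e₂ := hk m' (A.map φ α, K.map φ y) t (A'.map φ x)
        ((NatTrans.naturality_apply πA φ x).trans (congrArg (fun b => A.map φ b) hx))
        ((disc_app_map a' φ x).trans hx')
      have e₃ : G.app m' (A'.map φ x, K.map φ y) = G.app m (x, y) :=
        disc_app_map G φ ((x, y) : (A' ⊗ K).obj m)
      exact eq_of_heq (Sigma.mk.inj (e₂.symm.trans (e₃.trans e₁))).2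
    · ext; rfl
    · refine Subtype.ext ?_
      refine NatTrans.ext (funext fun m => ?_)
      ext ⟨x, y⟩
      exact (happ _ m x y).trans (hk m (πA.app m x, y) _ x rfl rfl).symm

/-- The comparison of mapping spaces is bijective on simplices, so it is an isomorphism and not only
an equivalence. -/
theorem isHDependentProduct_pi (hU : IsGrothendieckUniverse U) {T : Type u} {Z : T → Type u}
    (hT : USmall U T) (hS : USmall U (Σ t, Z t)) (hP : USmall U (∀ t, Z t))
    (h₁ : USmall U PUnit.{u + 1}) :
    IsHDependentProduct (discSpaceMap hT h₁ fun _ => PUnit.unit) (discSpaceMap hS hT Sigma.fst)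
      (discSpaceMap hP h₁ fun _ => PUnit.unit) := by
  have hW : USmall U ((∀ t, Z t) × T) := .prod hU hP hT
  have hq : IsPullback (discMap (Prod.fst : (∀ t, Z t) × T → _)) (discMap Prod.snd)
      (discMap fun _ => PUnit.unit.{u + 1}) (discMap fun _ => PUnit.unit) := by
    rw [isPullback_iff_app]
    intro n
    rw [Limits.Types.isPullback_iff]
    exact ⟨rfl, fun x y h => Prod.ext h.1 h.2, fun y z _ => ⟨(y, z), rfl, rfl⟩⟩
  refine ⟨discSpace hW, discSpaceMap hW hP Prod.fst, discSpaceMap hW hT Prod.snd, hq,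
    discSpaceMap hW hS fun w => ⟨w.2, w.1 w.2⟩, rfl, ?_⟩
  intro A A' a πA a' _ ha
  exact .of_bijective _ fun n => relHomPullback_bijective hq ha _

end DependentProduct

theorem isOneInaccessible_of_hDepProd {U : ZFSet.{u}} (hU : IsGrothendieckUniverse U)
    (h : HDepProd U) : IsOneInaccessible U := by
  have h₁ := USmall.punit hU
  refine isOneInaccessible_of_pi hU fun T₀ hT₀ => ?_
  obtain ⟨S, hS, hpb, ⟨E, B, t, ht, hcl⟩, hprod⟩ := h (discSpaceMap hT₀ h₁ fun _ => PUnit.unit)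
  -- The bound consists of pairs of a vertex of the total space and an edge of the base, enough to
  -- determine a point of a homotopy fibre.
  refine ⟨fun T => ∃ hT : USmall U T, S (discSpaceMap hT h₁ fun _ => PUnit.unit), ⟨hT₀, hS⟩, ?_,
    E.obj _⦋0⦌ × B.obj _⦋1⦌, .prod hU (E.property.2 _) (B.property.2 _), ?_⟩
  · rintro T Z ⟨hT, hTS⟩ hZ
    choose hZ hZS using hZ
    have hsig := USmall.sigma hU hT hZ
    choose σ hσ using fun i => exists_isCartesian_of_isContractible (hcl _ (hZS i))
    obtain ⟨τ, hτ⟩ := exists_isCartesian_glue σ hσ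
    exact ⟨.pi hU hT hZ, hprod _ _ _ (fibration_discMap _) (fibration_discMap _) hTS
      (hpb (discSpaceMap hsig hT Sigma.fst) t τ hτ ht) (isHDependentProduct_pi hU hT hsig _ h₁)⟩
  · rintro T ⟨hT, hTS⟩
    obtain ⟨σ, hσ⟩ := exists_isCartesian_of_isContractible (hcl _ hTS)
    exact hσ.nonempty_embedding

end InftyUniverse

theorem mainTheorem4 (U : ZFSet.{u}) (hU : InftyUniverse.IsGrothendieckUniverse U) :
    (InftyUniverse.HDepProd U → InftyUniverse.IsOneInaccessible U) ∧
      (InftyUniverse.DepProd (InftyUniverse.USet U) → InftyUniverse.IsOneInaccessible U) :=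
  ⟨InftyUniverse.isOneInaccessible_of_hDepProd hU, InftyUniverse.isOneInaccessible_of_depProd hU⟩
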